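/- **Setting.** A (conditional) prefix computer is a partial computable map that sends a binary program and a finite sequence of natural numbers (side information) to a binary string, such that for each side information the set of halting programs is prefix-free. Fix an additively optimal universal prefix computer $U$: for every prefix computer $T$ there is a constant $c_T$ with $K_U(s\mid y)\le K_T(s\mid y)+c_T$ for all $s,y$, where $K_T(s\mid y)$ is the length of a shortest program with which $T$, given $y$, prints $s$ and halts. Write $K=K_U$. For $\mathbf u\in[0,1]^n$ let $K(\mathbf u\mid n,m)$ be the length of a shortest program with which $U$, given $n$ and $m$, prints a finite binary expansion of $\mathbf u$ (the concatenation of binary expansions, of a common positive length, of its coordinates), and $\infty$ if $\mathbf u$ has none. For $\mathbf x\in[0,1]^n$ and $m\ge 1$ put $$K^{[\cdot]_m}(\mathbf x)=\inf\{K(\mathbf u\mid n,m):\ \mathbf u\in[0,1]^n,\ \|\mathbf x-\mathbf u\|_\infty\le 2^{-m}\},\qquad \kappa_{m,n}(\mathbf x)=\frac{K^{[\cdot]_m}(\mathbf x)}{m}.$$ **Theorem.** Let $d,m\ge1$ be integers, let $\mathbf x_o\in[0,1]^n$, and let $\kappa_{m,n}=\kappa_{m,n}(\mathbf x_o)$.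 Let $A$ be a random $d\times n$ matrix with i.i.d. $\mathcal N(0,1)$ entries, let $\mathbf w\in\mathbb R^d$ be a deterministic (fixed, independent of $A$) vector with $\|\mathbf w\|_2\le e$, and let $\mathbf y_o=A\mathbf x_o+\mathbf w$. Let $\hat{\mathbf x}_o$ be any solution of the low-complexity least squares (LLS) problem $$\text{minimize } \|A\mathbf x-\mathbf y_o\|_2\quad\text{over } \mathbf x\in[0,1]^n \text{ with } K^{[\cdot]_m}(\mathbf x)\le\kappa_{m,n}\,m .$$ Then for every $t\in(0,1)$, $$\mathbb P\left(\|\mathbf x_o-\hat{\mathbf x}_o\|_2>\left(\frac1{\sqrt{1-t}}\left(\sqrt{\frac nd}+2\right)+1\right)2^{-m}\sqrt n+\frac{e}{\sqrt{(1-t)d}}\right)\le 2^{\kappa_{m,n}m}\,\mathrm e^{\frac d2(t+\log(1-t))}+\mathrm e^{-\frac d2}.$$ -/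

import Mathlib

open MeasureTheory ProbabilityTheory
open scoped ENNReal

/-- A (conditional) prefix computer: a partial computable map taking a binary program and a finite
sequence of natural numbers, the side information, to a binary string, such that for every fixed
side information no halting program is a proper prefix of another halting program. -/
structure PrefixComputer where
  /-- The output of the computer on a program with given side information (undefined if the
  computation does not halt). -/
  run : List Bool → List ℕ →. List Bool
  partrec : Partrec₂ run
  prefixFree : ∀ (y : List ℕ) (p q : List Bool),
    (run p y).Dom → (run q y).Dom → p <+: q → p = q

/-- `U.complexity s y` is `K_U(s | y)`: the length of a shortest program with which `U`, having
access to `y`, prints `s` and halts (`⊤` if there is none). -/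
noncomputable def PrefixComputer.complexity (U : PrefixComputer) (s : List Bool) (y : List ℕ) :
    ℕ∞ :=
  ⨅ (p : List Bool) (_ : s ∈ U.run p y), (p.length : ℕ∞)

/-- `U` is an additively optimal universal computer: it is as good as any other prefix computer up
to an additive constant which depends on neither the string nor the side information. -/
def PrefixComputer.IsOptimal (U : PrefixComputer) : Prop :=
  ∀ T : PrefixComputer, ∃ c : ℕ, ∀ (s : List Bool) (y : List ℕ),
    U.complexity s y ≤ T.complexity s y + c

/-- The real number `0.b₁b₂…b_ℓ` written in base two. -/
noncomputable def binaryValue (b : List Bool) : ℝ :=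
  ∑ j : Fin b.length, if b[j] then (2 : ℝ)⁻¹ ^ ((j : ℕ) + 1) else 0

/-- `s` is the concatenation of binary expansions, of a common positive length `ℓ`, of the
coordinates of `u`. -/
def IsBinaryExpansion {n : ℕ} (s : List Bool) (u : EuclideanSpace ℝ (Fin n)) : Prop :=
  ∃ (ℓ : ℕ) (b : Fin n → List Bool), 0 < ℓ ∧ (∀ i, (b i).length = ℓ) ∧
    (∀ i, u i = binaryValue (b i)) ∧ s = (List.ofFn b).flatten

/-- The cube `[0,1]^n`. -/
def unitCube (n : ℕ) : Set (EuclideanSpace ℝ (Fin n)) :=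
  {x | ∀ i, x i ∈ Set.Icc (0 : ℝ) 1}

/-- `vectorComplexity U u y` is `K(u | y)` for a real vector `u`: the length of a shortest program
that prints a finite binary expansion of `u` (`⊤` if `u` has no finite binary expansion). -/
noncomputable def vectorComplexity (U : PrefixComputer) {n : ℕ} (u : EuclideanSpace ℝ (Fin n))
    (y : List ℕ) : ℕ∞ :=
  ⨅ (s : List Bool) (_ : IsBinaryExpansion s u), U.complexity s y

/-- The Kolmogorov complexity of `x ∈ [0,1]^n` at resolution `m`: the infimum of `K(u | n, m)` over
all `u ∈ [0,1]^n` with `‖x - u‖_∞ ≤ 2^{-m}`. -/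
noncomputable def resolutionComplexity (U : PrefixComputer) (m : ℕ) {n : ℕ}
    (x : EuclideanSpace ℝ (Fin n)) : ℕ∞ :=
  ⨅ (u : EuclideanSpace ℝ (Fin n)) (_ : u ∈ unitCube n)
    (_ : ∀ i, |x i - u i| ≤ (2 : ℝ)⁻¹ ^ m), vectorComplexity U u [n, m]

/-- The complexity at resolution `m` of a point of the cube is finite for an optimal computer. -/
theorem resolutionComplexity_ne_top (U : PrefixComputer) (hU : U.IsOptimal) (m : ℕ) {n : ℕ}
    (x : EuclideanSpace ℝ (Fin n)) (hx : x ∈ unitCube n) : resolutionComplexity U m x ≠ ⊤ := by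
  have hstr : ∀ (s : List Bool) (y : List ℕ), U.complexity s y ≠ ⊤ := by
    intro s y
    let T : PrefixComputer :=
      { run := fun p _ => (if p = [] then some s else none : Option (List Bool))
        partrec := by
          refine Computable.ofOption ?_
          refine Computable.of_eq (f := fun q : List Bool × List ℕ =>
            cond (decide (q.1 = [])) (some s) none) ?_ ?_
          · refine Computable.cond ?_ (Computable.const _) (Computable.const _)
            exact (Primrec.eq.comp Primrec.fst (Primrec.const [])).decide.to_comp
          · intro q
            by_cases h : q.1 = [] <;> simp [h]
        prefixFree := by
          intro y p q hp hq _
          have key : ∀ p : List Bool,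
              ((if p = [] then some s else none : Option (List Bool)) : Part (List Bool)).Dom →
                p = [] := by
            intro p hp
            by_contra h
            simp [h] at hp
          rw [key p hp, key q hq] }
    obtain ⟨c, hc⟩ := hU T
    have hT : T.complexity s y ≤ 0 := by
      refine (iInf₂_le ([] : List Bool) ?_).trans (by simp)
      simp [T]
    have := (hc s y).trans (add_le_add_left hT _)
    intro h
    rw [h] at this
    simp at this
  have happrox : ∀ (k : ℕ) (r : ℝ), r ∈ Set.Icc (0 : ℝ) 1 → ∃ b : List Bool, b.length = k ∧
      binaryValue b ∈ Set.Icc (0 : ℝ) 1 ∧ |r - binaryValue b| ≤ (2 : ℝ)⁻¹ ^ k := by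
    have hcons : ∀ (a : Bool) (b : List Bool),
        binaryValue (a :: b) = (if a then 2⁻¹ else 0) + 2⁻¹ * binaryValue b := by
      intro a b
      unfold binaryValue
      erw [Fin.sum_univ_succ]
      congr 1
      · simp
      · rw [Finset.mul_sum]
        refine Finset.sum_congr rfl fun j _ => ?_
        simp only [Fin.getElem_fin, Fin.val_succ, List.getElem_cons_succ]
        split_ifs
        · ring
        · simp
    intro k
    induction k with
    | zero =>
      intro r hr
      refine ⟨[], rfl, by simp [binaryValue], ?_⟩
      simp only [binaryValue, List.length_nil, Finset.univ_eq_empty, Finset.sum_empty, sub_zero,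
        pow_zero]
      exact abs_le.2 ⟨by linarith [hr.1], hr.2⟩
    | succ k ih =>
      intro r hr
      obtain ⟨hr0, hr1⟩ := hr
      by_cases h : r ≤ 1 / 2
      · obtain ⟨b, hb, hb1, hb2⟩ := ih (2 * r) ⟨by linarith, by linarith⟩
        refine ⟨false :: b, by simp [hb], ?_, ?_⟩
        · rw [hcons]
          simp only [Bool.false_eq_true, if_false, zero_add]
          exact ⟨by linarith [hb1.1], by linarith [hb1.2]⟩
        · rw [hcons, pow_succ]
          simp only [Bool.false_eq_true, if_false, zero_add]
          rw [abs_le] at hb2 ⊢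
          exact ⟨by linarith [hb2.1], by linarith [hb2.2]⟩
      · obtain ⟨b, hb, hb1, hb2⟩ := ih (2 * r - 1) ⟨by linarith, by linarith⟩
        refine ⟨true :: b, by simp [hb], ?_, ?_⟩
        · rw [hcons]
          simp only [if_true]
          exact ⟨by linarith [hb1.1], by linarith [hb1.2]⟩
        · rw [hcons, pow_succ]
          simp only [if_true]
          rw [abs_le] at hb2 ⊢
          exact ⟨by linarith [hb2.1], by linarith [hb2.2]⟩
  choose b hb hb1 hb2 using fun i => happrox (m + 1) (x i) (hx i)
  have hle : resolutionComplexity U m x ≤ U.complexity (List.ofFn b).flatten [n, m] := by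
    refine (iInf_le _ (WithLp.toLp 2 fun i => binaryValue (b i))).trans ?_
    refine (iInf₂_le (fun i => hb1 i) fun i => (hb2 i).trans ?_).trans ?_
    · exact pow_le_pow_of_le_one (by norm_num) (by norm_num) (Nat.le_succ m)
    · exact iInf₂_le _ ⟨m + 1, b, Nat.succ_pos m, hb, fun i => rfl, rfl⟩
  exact ne_top_of_le_ne_top (hstr _ _) hle

/-- The Kolmogorov information dimension of `x` at resolution `m`. (The complexity of a point of the
cube is finite for an optimal `U`, see `resolutionComplexity_ne_top`.) -/
noncomputable def kid (U : PrefixComputer) (m : ℕ) {n : ℕ} (x : EuclideanSpace ℝ (Fin n)) : ℝ :=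
  ((resolutionComplexity U m x).toNat : ℝ) / (m : ℝ)

/-- The vector `A x`, with the Euclidean norm. -/
noncomputable def applyMatrix {d n : ℕ} (A : Matrix (Fin d) (Fin n) ℝ) (x : EuclideanSpace ℝ (Fin n)) :
    EuclideanSpace ℝ (Fin d) :=
  WithLp.toLp 2 (A.mulVec x.ofLp)

/-- The feasible set of low-complexity least squares: the points of `[0,1]^n` whose complexity at
resolution `m` is at most `κ m`. -/
def llsFeasible (U : PrefixComputer) (m n : ℕ) (κ : ℝ) : Set (EuclideanSpace ℝ (Fin n)) :=
  {x | x ∈ unitCube n ∧ (resolutionComplexity U m x : ℝ≥0∞) ≤ ENNReal.ofReal (κ * m)}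

/-- `x` is a solution of low-complexity least squares: a minimizer of `‖A x - y‖₂` over the feasible
set. -/
def IsLLSSolution (U : PrefixComputer) (m : ℕ) (κ : ℝ) {d n : ℕ} (A : Matrix (Fin d) (Fin n) ℝ)
    (y : EuclideanSpace ℝ (Fin d)) (x : EuclideanSpace ℝ (Fin n)) : Prop :=
  x ∈ llsFeasible U m n κ ∧ ∀ z ∈ llsFeasible U m n κ, ‖applyMatrix A x - y‖ ≤ ‖applyMatrix A z - y‖

/-!
Let `x̂` be the least squares solution and `u` a vector with a program of length at most `k = κ m`
that is `2⁻ᵐ`-close to `x̂`. Programs of a prefix computer are prefix-free, so there are at most `2ᵏ`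
candidates for `u` (`finite_describableVectors_and_ncard_le`). The true vector is feasible and has
residual `w`, so `‖A (x̂ - x₀) - w‖ ≤ ‖w‖ ≤ e`, and hence `‖A (u - x₀) - w‖ ≤ e + ‖A (u - x̂)‖`.

The noise is kept inside the norm on the left. For each fixed `u` the Chernoff bound for
`‖A (u - x₀) - w‖` is, whatever `w`, at least as good as the one for `w = 0`, which yields
`‖A (u - x₀) - w‖ > √((1 - t) d) ‖u - x₀‖` outside probability `exp (d / 2 (t + log (1 - t)))`
(`gaussianEntries_smallBall_le`). This is why the error is `e / √((1 - t) d)`, without a factor `2`.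

The term `‖A (u - x̂)‖` needs only the supremum of `‖A h‖` over the cube `‖h‖_∞ ≤ 2⁻ᵐ`, not the
operator norm of `A`, and this allows an elementary proof without Gaussian comparison or
concentration inequalities (`gaussianEntries_cube_le`). By duality the supremum over `[-1, 1]ⁿ` is that
of `‖Aᵀ v‖₁` over unit vectors `v`, and it is attained at a vertex. For `n ≤ 36 d` a union bound over the
vertices suffices. For `n ≥ 36 d` one uses that `‖Aᵀ v‖₁` has mean `√(2 / π) n`, strictly below `n`, and
a volume argument on the unit ball of `ℝᵈ` for the supremum over `v`.
-/

/-! ### Exponential moments of normal variables -/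

/-- The exponential moment of `(g - c) ^ 2` for a standard normal `g`. For `a ≥ 0` it says that moving
the centre away from `0` only decreases `𝔼 exp (-a (g - c) ^ 2)`; a negative `a` is allowed for `c = 0`. -/
theorem lintegral_exp_neg_mul_sub_sq_gaussianReal_le {a c : ℝ} (ha : 0 < 1 + 2 * a)
    (hac : 0 ≤ a * c ^ 2) :
    ∫⁻ x, ENNReal.ofReal (Real.exp (-(a * (x - c) ^ 2))) ∂(gaussianReal 0 1) ≤
      ENNReal.ofReal (√(1 + 2 * a))⁻¹ := by
  set b := 1 + 2 * a with hb
  have hb0 : b ≠ 0 := ha.ne'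
  obtain ⟨v, hvb⟩ : ∃ v : NNReal, (v : ℝ) = b⁻¹ := ⟨⟨b⁻¹, (inv_pos.2 ha).le⟩, rfl⟩
  have hv : v ≠ 0 := by
    rintro rfl
    exact hb0 (inv_eq_zero.1 (by simpa using hvb.symm))
  rw [gaussianReal_of_var_ne_zero _ one_ne_zero,
    lintegral_withDensity_eq_lintegral_mul _ (measurable_gaussianPDF _ _) (by fun_prop)]
  -- Completing the square gives the density of `𝒩(2ac/b, 1/b)` times `b^{-1/2} exp (-a c² / b)`.
  have key : ∀ x : ℝ, gaussianPDFReal 0 1 x * Real.exp (-(a * (x - c) ^ 2)) ≤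
      (√b)⁻¹ * gaussianPDFReal (2 * a * c / b) v x := by
    intro x
    have e1 : (√(2 * Real.pi * b⁻¹))⁻¹ = (√(2 * Real.pi))⁻¹ * √b := by
      rw [Real.sqrt_mul (by positivity), Real.sqrt_inv, mul_inv, inv_inv]
    have hsb : (√b)⁻¹ * √b = 1 := inv_mul_cancel₀ (Real.sqrt_ne_zero'.2 ha)
    have e2 : -x ^ 2 / 2 + -(a * (x - c) ^ 2) ≤ -(x - 2 * a * c / b) ^ 2 / (2 * b⁻¹) := by
      have : -(x - 2 * a * c / b) ^ 2 / (2 * b⁻¹) =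
          -x ^ 2 / 2 + -(a * (x - c) ^ 2) + a * c ^ 2 / b := by
        field_simp
        rw [hb]; ring
      rw [this]
      have : 0 ≤ a * c ^ 2 / b := div_nonneg hac ha.le
      linarith
    simp only [gaussianPDFReal, NNReal.coe_one, mul_one, sub_zero, hvb]
    rw [e1, mul_assoc, ← Real.exp_add]
    calc (√(2 * Real.pi))⁻¹ * Real.exp (-x ^ 2 / 2 + -(a * (x - c) ^ 2))
        ≤ (√(2 * Real.pi))⁻¹ * Real.exp (-(x - 2 * a * c / b) ^ 2 / (2 * b⁻¹)) := by gcongr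
      _ = ((√b)⁻¹ * √b) * ((√(2 * Real.pi))⁻¹ *
            Real.exp (-(x - 2 * a * c / b) ^ 2 / (2 * b⁻¹))) := by rw [hsb, one_mul]
      _ = _ := by ring
  calc _ ≤ ∫⁻ x, ENNReal.ofReal (√b)⁻¹ *
        gaussianPDF (2 * a * c / b) v x := by
        refine lintegral_mono fun x => ?_
        simp only [Pi.mul_apply, gaussianPDF]
        rw [← ENNReal.ofReal_mul (gaussianPDFReal_nonneg _ _ _), ← ENNReal.ofReal_mul (by positivity)]
        exact ENNReal.ofReal_le_ofReal (key x)
    _ = _ := by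
        rw [lintegral_const_mul _ (measurable_gaussianPDF _ _), lintegral_gaussianPDF_eq_one _ hv,
          mul_one]

/-- The factor `√(2 / π)`, the mean of `|g|`, is what matters: the cheaper bound `2 exp (l ^ 2 / 2)`
is too large for small `l`. -/
theorem lintegral_exp_mul_abs_gaussianReal_le {l : ℝ} (hl : 0 ≤ l) :
    ∫⁻ x, ENNReal.ofReal (Real.exp (l * |x|)) ∂(gaussianReal 0 1) ≤
      ENNReal.ofReal (Real.exp (l ^ 2 / 2) * (1 + l * √(2 / Real.pi))) := by
  have hint : Integrable fun x : ℝ => Real.exp (-(1 / 2) * x ^ 2) :=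
    integrable_exp_neg_mul_sq (by norm_num)
  have hintl : Integrable fun x : ℝ => Real.exp (-(1 / 2) * (x - l) ^ 2) := hint.comp_sub_right l
  have hhalf : ∫ x in Set.Ioi (0 : ℝ), Real.exp (-(1 / 2) * (x - l) ^ 2) ≤
      l + √(2 * Real.pi) / 2 := by
    have h1 : ∫ x in Set.Ioi (0 : ℝ), Real.exp (-(1 / 2) * (x - l) ^ 2) =
        ∫ x in Set.Ioi (-l), Real.exp (-(1 / 2) * x ^ 2) := by
      have := (measurePreserving_sub_right volume l).setIntegral_preimage_emb
        (MeasurableEquiv.subRight l).measurableEmbedding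
        (fun x : ℝ => Real.exp (-(1 / 2) * x ^ 2)) (Set.Ioi (-l))
      simpa using this
    have h2 : Set.Ioi (-l) = Set.Ioc (-l) 0 ∪ Set.Ioi 0 :=
      (Set.Ioc_union_Ioi_eq_Ioi (by linarith)).symm
    rw [h1, h2, setIntegral_union (Set.Ioc_disjoint_Ioi le_rfl) measurableSet_Ioi
      hint.integrableOn hint.integrableOn, integral_gaussian_Ioi]
    have h3 : ∫ x in Set.Ioc (-l) 0, Real.exp (-(1 / 2) * x ^ 2) ≤ l := by
      have : ∫ x in Set.Ioc (-l) 0, Real.exp (-(1 / 2) * x ^ 2) ≤ ∫ x in Set.Ioc (-l) 0, (1 : ℝ) :=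
        integral_mono hint.integrableOn (by simp) fun x =>
          Real.exp_le_one_iff.2 (by nlinarith [sq_nonneg x])
      simpa [hl] using this
    have h4 : Real.pi / (1 / 2) = 2 * Real.pi := by ring
    rw [h4]
    linarith
  have hmain : ∫ x : ℝ, Real.exp (-(1 / 2) * (|x| - l) ^ 2) ≤ 2 * l + √(2 * Real.pi) := by
    rw [integral_comp_abs (f := fun x => Real.exp (-(1 / 2) * (x - l) ^ 2))]
    linarith
  have hintabs : Integrable fun x : ℝ => Real.exp (-(1 / 2) * (|x| - l) ^ 2) := by
    refine (hintl.add (hint.comp_add_right l)).mono' (by fun_prop) (ae_of_all _ fun x => ?_)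
    rw [Real.norm_of_nonneg (Real.exp_pos _).le, Pi.add_apply]
    rcases abs_cases x with ⟨h, -⟩ | ⟨h, -⟩
    · rw [h]
      exact le_add_of_nonneg_right (Real.exp_pos _).le
    · rw [h, show (-x - l) ^ 2 = (x + l) ^ 2 by ring]
      exact le_add_of_nonneg_left (Real.exp_pos _).le
  have key : ∀ x : ℝ, gaussianPDFReal 0 1 x * Real.exp (l * |x|) =
      Real.exp (l ^ 2 / 2) * (√(2 * Real.pi))⁻¹ * Real.exp (-(1 / 2) * (|x| - l) ^ 2) := by
    intro x
    simp only [gaussianPDFReal, NNReal.coe_one, mul_one, sub_zero]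
    rw [mul_assoc, ← Real.exp_add, mul_comm (Real.exp (l ^ 2 / 2)), mul_assoc, ← Real.exp_add,
      ← sq_abs x]
    ring_nf
  rw [gaussianReal_of_var_ne_zero _ one_ne_zero,
    lintegral_withDensity_eq_lintegral_mul _ (measurable_gaussianPDF _ _) (by fun_prop)]
  calc _ = ∫⁻ x : ℝ, ENNReal.ofReal (Real.exp (l ^ 2 / 2) * (√(2 * Real.pi))⁻¹ *
        Real.exp (-(1 / 2) * (|x| - l) ^ 2)) := by
        refine lintegral_congr fun x => ?_
        simp only [Pi.mul_apply, gaussianPDF]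
        rw [← ENNReal.ofReal_mul (gaussianPDFReal_nonneg _ _ _), key]
    _ = ENNReal.ofReal (∫ x : ℝ, Real.exp (l ^ 2 / 2) * (√(2 * Real.pi))⁻¹ *
        Real.exp (-(1 / 2) * (|x| - l) ^ 2)) :=
        (ofReal_integral_eq_lintegral_ofReal (hintabs.const_mul _)
          (ae_of_all _ fun x => by positivity)).symm
    _ ≤ _ := by
        refine ENNReal.ofReal_le_ofReal ?_
        rw [integral_const_mul, mul_assoc]
        have hs : 0 < √(2 * Real.pi) := by positivity
        have h2 : √(2 / Real.pi) = 2 * (√(2 * Real.pi))⁻¹ := by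
          rw [← div_eq_mul_inv, eq_div_iff hs.ne', ← Real.sqrt_mul (by positivity)]
          rw [show 2 / Real.pi * (2 * Real.pi) = 2 ^ 2 by field_simp]
          simp
        have h3 : 1 + l * √(2 / Real.pi) = (√(2 * Real.pi))⁻¹ * (2 * l + √(2 * Real.pi)) := by
          rw [h2]
          field_simp
          ring
        rw [h3]
        gcongr

/-- The exponent `3 / 11` is `3 / 10` times the factor `10 / 11` by which a point of the unit sphere is
shrunk in `gaussianEntries_exists_colSum_ge_le`; that it is reached at all rests on `√(2 / π) < 10 / 11`. -/
theorem lintegral_exp_abs_gaussianReal_le {ρ : ℝ} (hρ : |ρ| ≤ 1) :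
    ∫⁻ x, ENNReal.ofReal (Real.exp (3 / 10 * |ρ * x|)) ∂(gaussianReal 0 1) ≤
      ENNReal.ofReal (Real.exp (3 / 11)) := by
  calc _ ≤ ∫⁻ x, ENNReal.ofReal (Real.exp (3 / 10 * |x|)) ∂(gaussianReal 0 1) := by
        refine lintegral_mono fun x => ENNReal.ofReal_le_ofReal (Real.exp_le_exp.2 ?_)
        rw [abs_mul]
        have := mul_le_mul_of_nonneg_right hρ (abs_nonneg x)
        linarith
    _ ≤ ENNReal.ofReal (Real.exp ((3 / 10) ^ 2 / 2) * (1 + 3 / 10 * √(2 / Real.pi))) :=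
        lintegral_exp_mul_abs_gaussianReal_le (by norm_num)
    _ ≤ _ := by
        refine ENNReal.ofReal_le_ofReal ?_
        have h1 : √(2 / Real.pi) ≤ 4 / 5 := by
          refine Real.sqrt_le_iff.2 ⟨by norm_num, ?_⟩
          rw [div_le_iff₀ Real.pi_pos]
          nlinarith [Real.pi_gt_d2]
        have h2 : Real.exp ((3 / 10) ^ 2 / 2) ≤ 1.0461 := by
          refine (Real.exp_bound' (by norm_num) (by norm_num) (n := 3) (by norm_num)).trans ?_
          norm_num [Finset.sum_range_succ, Nat.factorial]
        have h3 : (1.313 : ℝ) ≤ Real.exp (3 / 11) := by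
          refine le_trans ?_ (Real.sum_le_exp_of_nonneg (by norm_num) 4)
          norm_num [Finset.sum_range_succ, Nat.factorial]
        calc _ ≤ (1.0461 : ℝ) * (1 + 3 / 10 * (4 / 5)) := by gcongr
          _ ≤ 1.313 := by norm_num
          _ ≤ Real.exp (3 / 11) := h3

/-- A map `L` which turns the linear form `s` into the linear form `r` pulls the characteristic function
of the Gaussian measure at `s` back to that at `r`. -/
theorem charFun_map_pi_gaussianReal {β ι : Type*} [Fintype β] [Fintype ι]
    {L : (β → ℝ) → ι → ℝ} (hL : Measurable L) (s : EuclideanSpace ℝ ι) (r : EuclideanSpace ℝ β)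
    (h : ∀ x : β → ℝ, inner ℝ (WithLp.toLp 2 (L x)) s = inner ℝ (WithLp.toLp 2 x) r) :
    charFun (((Measure.pi fun _ : β => gaussianReal 0 1).map L).map
      (MeasurableEquiv.toLp 2 (ι → ℝ))) s = Complex.exp (-(‖r‖ : ℂ) ^ 2 / 2) := by
  have hm := (MeasurableEquiv.toLp 2 (ι → ℝ)).measurable
  rw [Measure.map_map hm hL, ← charFun_stdGaussian, ← map_pi_eq_stdGaussian, charFun_apply,
    charFun_apply, integral_map (hm.comp hL).aemeasurable (by fun_prop),
    integral_map (by fun_prop) (by fun_prop)]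
  refine integral_congr_ae (ae_of_all _ fun x => ?_)
  simp only [Function.comp, MeasurableEquiv.toLp_apply]
  rw [h x]

/-- A family of `ι` orthogonal linear forms of squared norm `ρ ^ 2`, applied to a vector of
independent standard normals, is distributed as `ρ` times such a vector. -/
theorem map_linearForms_pi_gaussianReal {α ι : Type*} [Fintype α] [Fintype ι]
    (c : ι → α → ℝ) (ρ : ℝ)
    (hc : ∀ s : ι → ℝ, ∑ a, (∑ i, s i * c i a) ^ 2 = ρ ^ 2 * ∑ i, s i ^ 2) :
    (Measure.pi fun _ : α => gaussianReal 0 1).map (fun B i => ∑ a, c i a * B a) =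
      (Measure.pi fun _ : ι => gaussianReal 0 1).map fun g i => ρ * g i := by
  have hmL : Measurable fun (B : α → ℝ) (i : ι) => ∑ a, c i a * B a := by fun_prop
  have hmR : Measurable fun (g : ι → ℝ) (i : ι) => ρ * g i := by fun_prop
  have hm := (MeasurableEquiv.toLp 2 (ι → ℝ)).measurable
  apply (MeasurableEquiv.toLp 2 (ι → ℝ)).map_measurableEquiv_injective
  have := Measure.isProbabilityMeasure_map (μ := Measure.pi fun _ : α => gaussianReal 0 1)
    hmL.aemeasurable
  have := Measure.isProbabilityMeasure_map (μ := Measure.pi fun _ : ι => gaussianReal 0 1)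
    hmR.aemeasurable
  have := Measure.isProbabilityMeasure_map
    (μ := (Measure.pi fun _ : α => gaussianReal 0 1).map (fun B i => ∑ a, c i a * B a))
    hm.aemeasurable
  have := Measure.isProbabilityMeasure_map
    (μ := (Measure.pi fun _ : ι => gaussianReal 0 1).map (fun g i => ρ * g i)) hm.aemeasurable
  refine Measure.ext_of_charFun (E := EuclideanSpace ℝ ι) ?_
  ext s
  rw [charFun_map_pi_gaussianReal hmL s (WithLp.toLp 2 fun a => ∑ i, s i * c i a),
    charFun_map_pi_gaussianReal hmR s (ρ • s)]
  · have h1 : ‖(WithLp.toLp 2 fun a => ∑ i, s i * c i a : EuclideanSpace ℝ α)‖ ^ 2 =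
        ‖ρ • (s : EuclideanSpace ℝ ι)‖ ^ 2 := by
      rw [norm_smul, mul_pow, EuclideanSpace.real_norm_sq_eq, EuclideanSpace.real_norm_sq_eq, hc,
        Real.norm_eq_abs, sq_abs]
    have h2 := congrArg (fun x : ℝ => (x : ℂ)) h1
    simp only [Complex.ofReal_pow] at h2
    rw [h2]
  · intro x
    simp only [PiLp.inner_apply, PiLp.smul_apply, RCLike.inner_apply, conj_trivial, smul_eq_mul]
    exact Finset.sum_congr rfl fun i _ => by ring
  · intro x
    simp only [PiLp.inner_apply, RCLike.inner_apply, conj_trivial, Finset.sum_mul, Finset.mul_sum]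
    rw [Finset.sum_comm]
    exact Finset.sum_congr rfl fun i _ => Finset.sum_congr rfl fun j _ => by ring

theorem lintegral_prod_linearForms {α ι : Type*} [Fintype α] [Fintype ι]
    (c : ι → α → ℝ) (ρ : ℝ)
    (hc : ∀ s : ι → ℝ, ∑ a, (∑ i, s i * c i a) ^ 2 = ρ ^ 2 * ∑ i, s i ^ 2)
    (F : ι → ℝ → ℝ≥0∞) (hF : ∀ i, Measurable (F i)) :
    ∫⁻ B, ∏ i, F i (∑ a, c i a * B a) ∂(Measure.pi fun _ : α => gaussianReal 0 1) =
      ∏ i, ∫⁻ x, F i (ρ * x) ∂(gaussianReal 0 1) := by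
  have hm : Measurable fun y : ι → ℝ => ∏ i, F i (y i) := by fun_prop
  have h := congrArg (fun m => ∫⁻ y, ∏ i, F i (y i) ∂m) (map_linearForms_pi_gaussianReal c ρ hc)
  rw [lintegral_map hm (by fun_prop), lintegral_map hm (by fun_prop)] at h
  rw [h, lintegral_prod_eq_prod_lintegral_of_indepFun Finset.univ
    (fun i (g : ι → ℝ) => F i (ρ * g i))
    (iIndepFun_pi (X := fun i x => F i (ρ * x)) fun i => by fun_prop) fun i => by fun_prop]
  refine Finset.prod_congr rfl fun i _ => ?_
  exact (measurePreserving_eval (fun _ : ι => gaussianReal 0 1) i).lintegral_comp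
    (f := fun x => F i (ρ * x)) (by fun_prop)

/-- The entries of `B x` are independent of law `𝒩(0, ‖x‖²)`, in terms of integrals of products. -/
theorem lintegral_prod_rows {ι κ : Type*} [Fintype ι] [Fintype κ] (x : EuclideanSpace ℝ κ)
    (F : ι → ℝ → ℝ≥0∞) (hF : ∀ i, Measurable (F i)) :
    ∫⁻ B, ∏ i, F i (∑ j, B (i, j) * x j) ∂(Measure.pi fun _ : ι × κ => gaussianReal 0 1) =
      ∏ i, ∫⁻ y, F i (‖x‖ * y) ∂(gaussianReal 0 1) := by
  classical
  rw [← lintegral_prod_linearForms (fun i (p : ι × κ) => if p.1 = i then x p.2 else 0) ‖x‖ _ F hF]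
  · refine lintegral_congr fun B => Finset.prod_congr rfl fun i _ => ?_
    simp [Fintype.sum_prod_type, mul_comm]
  · intro s
    simp [Fintype.sum_prod_type, EuclideanSpace.real_norm_sq_eq, mul_pow, Finset.mul_sum,
      mul_comm]
    exact Finset.sum_comm

/-- The entries of `Bᵀ v` are independent of law `𝒩(0, ‖v‖²)`, in terms of integrals of products. -/
theorem lintegral_prod_cols {ι κ : Type*} [Fintype ι] [Fintype κ] (v : EuclideanSpace ℝ ι)
    (F : κ → ℝ → ℝ≥0∞) (hF : ∀ j, Measurable (F j)) :
    ∫⁻ B, ∏ j, F j (∑ i, B (i, j) * v i) ∂(Measure.pi fun _ : ι × κ => gaussianReal 0 1) =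
      ∏ j, ∫⁻ x, F j (‖v‖ * x) ∂(gaussianReal 0 1) := by
  classical
  rw [← lintegral_prod_linearForms (fun j (p : ι × κ) => if p.2 = j then v p.1 else 0) ‖v‖ _ F hF]
  · refine lintegral_congr fun B => Finset.prod_congr rfl fun i _ => ?_
    simp [Fintype.sum_prod_type, mul_comm]
  · intro s
    simp [Fintype.sum_prod_type, EuclideanSpace.real_norm_sq_eq, mul_pow, Finset.mul_sum,
      mul_comm]

/-! ### Tail bounds for the image of a fixed vector -/

theorem measure_le_lintegral_of_one_le {α : Type*} [MeasurableSpace α] {P : Measure α} {S : Set α}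
    {G : α → ℝ≥0∞} (hG : Measurable G) (h : ∀ x ∈ S, 1 ≤ G x) : P S ≤ ∫⁻ x, G x ∂P := by
  calc P S ≤ P {x | 1 ≤ G x} := measure_mono h
    _ = 1 * P {x | 1 ≤ G x} := (one_mul _).symm
    _ ≤ _ := mul_meas_ge_le_lintegral hG 1

/-- The matrix with entries `B (i, j)`. -/
def matrixOfEntries {d n : ℕ} (B : Fin d × Fin n → ℝ) : Matrix (Fin d) (Fin n) ℝ :=
  Matrix.of fun i j => B (i, j)

/-- The law of the entries of a `d × n` matrix of independent standard normals. -/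
noncomputable def gaussianEntries (d n : ℕ) : Measure (Fin d × Fin n → ℝ) :=
  Measure.pi fun _ => gaussianReal 0 1

instance isProbabilityMeasure_gaussianEntries (d n : ℕ) : IsProbabilityMeasure (gaussianEntries d n) := by
  unfold gaussianEntries; infer_instance

theorem applyMatrix_apply {d n : ℕ} (B : Fin d × Fin n → ℝ) (x : EuclideanSpace ℝ (Fin n))
    (i : Fin d) : applyMatrix (matrixOfEntries B) x i = ∑ j, B (i, j) * x j := rfl

theorem norm_applyMatrix_sub_sq {d n : ℕ} (B : Fin d × Fin n → ℝ) (x : EuclideanSpace ℝ (Fin n))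
    (w : EuclideanSpace ℝ (Fin d)) :
    ‖applyMatrix (matrixOfEntries B) x - w‖ ^ 2 = ∑ i, (∑ j, B (i, j) * x j - w i) ^ 2 := by
  rw [EuclideanSpace.real_norm_sq_eq]
  rfl

/-- The exponential moment of `‖A x - w‖ ^ 2`, one factor for each row. The hypothesis on `a` holds if
`0 ≤ a`, and also if `w = 0`, where `-1 / 2 < a < 0` is allowed. -/
theorem lintegral_exp_neg_norm_applyMatrix_sub_sq_le {d n : ℕ} {x : EuclideanSpace ℝ (Fin n)}
    (hx : x ≠ 0) (w : EuclideanSpace ℝ (Fin d)) {a : ℝ} (ha : 0 < 1 + 2 * a)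
    (haw : ∀ i, 0 ≤ a * w i ^ 2) :
    ∫⁻ B, ENNReal.ofReal (Real.exp (-(a / ‖x‖ ^ 2 *
      ‖applyMatrix (matrixOfEntries B) x - w‖ ^ 2))) ∂(gaussianEntries d n) ≤
      ENNReal.ofReal ((√(1 + 2 * a))⁻¹ ^ d) := by
  have hx0 : 0 < ‖x‖ := norm_pos_iff.2 hx
  calc _ = ∫⁻ B, ∏ i, (fun y => ENNReal.ofReal (Real.exp (-(a / ‖x‖ ^ 2 * (y - w i) ^ 2))))
        (∑ j, B (i, j) * x j) ∂(gaussianEntries d n) := by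
        refine lintegral_congr fun B => ?_
        rw [norm_applyMatrix_sub_sq, Finset.mul_sum, ← Finset.sum_neg_distrib, Real.exp_sum,
          ENNReal.ofReal_prod_of_nonneg fun i _ => (Real.exp_pos _).le]
    _ = ∏ i, ∫⁻ y, ENNReal.ofReal (Real.exp (-(a / ‖x‖ ^ 2 * (‖x‖ * y - w i) ^ 2)))
          ∂(gaussianReal 0 1) :=
        lintegral_prod_rows x
          (fun i y => ENNReal.ofReal (Real.exp (-(a / ‖x‖ ^ 2 * (y - w i) ^ 2))))
          fun i => by fun_prop
    _ ≤ ∏ _i : Fin d, ENNReal.ofReal (√(1 + 2 * a))⁻¹ := by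
        refine Finset.prod_le_prod' fun i _ => ?_
        have hac : 0 ≤ a * (w i / ‖x‖) ^ 2 := by
          rw [div_pow, ← mul_div_assoc]
          exact div_nonneg (haw i) (by positivity)
        refine le_trans (le_of_eq ?_) (lintegral_exp_neg_mul_sub_sq_gaussianReal_le ha hac)
        refine lintegral_congr fun y => ?_
        congr 3
        field_simp
    _ = _ := by
        rw [Finset.prod_const, Finset.card_univ, Fintype.card_fin,
          ENNReal.ofReal_pow (by positivity)]

theorem measurable_applyMatrix {d n : ℕ} (x : EuclideanSpace ℝ (Fin n)) :
    Measurable fun B : Fin d × Fin n → ℝ => applyMatrix (matrixOfEntries B) x := by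
  have h : (fun B : Fin d × Fin n → ℝ => applyMatrix (matrixOfEntries B) x) =
      fun B => WithLp.toLp 2 fun i => ∑ j, B (i, j) * x j := rfl
  rw [h]
  fun_prop

/-- The lower tail of `‖A x - w‖` obeys, for every fixed `w`, the Chernoff bound for the lower tail of
a chi-squared variable with `d` degrees of freedom: Gaussian mass is largest around the origin. -/
theorem gaussianEntries_smallBall_le {d n : ℕ} {x : EuclideanSpace ℝ (Fin n)}
    (hx : x ≠ 0) (w : EuclideanSpace ℝ (Fin d)) {t : ℝ} (ht : t ∈ Set.Ioo (0 : ℝ) 1) :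
    gaussianEntries d n {B | ‖applyMatrix (matrixOfEntries B) x - w‖ ≤ √((1 - t) * d) * ‖x‖} ≤
      ENNReal.ofReal (Real.exp ((d : ℝ) / 2 * (t + Real.log (1 - t)))) := by
  obtain ⟨ht0, ht1⟩ := ht
  have h1t : 0 < 1 - t := by linarith
  have hx0 : 0 < ‖x‖ := norm_pos_iff.2 hx
  set a : ℝ := t / (2 * (1 - t)) with ha
  -- This `a` is the minimizer in the Chernoff bound; it makes `1 + 2 a = (1 - t)⁻¹`.
  have ha0 : 0 < a := by positivity
  have hm := measurable_applyMatrix (d := d) x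
  refine (measure_le_lintegral_of_one_le
    (G := fun B => ENNReal.ofReal (Real.exp (d * t / 2)) * ENNReal.ofReal (Real.exp
      (-(a / ‖x‖ ^ 2 * ‖applyMatrix (matrixOfEntries B) x - w‖ ^ 2))))
    (by fun_prop) ?_).trans ?_
  · intro B hB
    rw [Set.mem_ofPred_eq] at hB
    rw [← ENNReal.ofReal_mul (Real.exp_pos _).le, ← Real.exp_add, ← ENNReal.ofReal_one]
    refine ENNReal.ofReal_le_ofReal (Real.one_le_exp ?_)
    have h2 : ‖applyMatrix (matrixOfEntries B) x - w‖ ^ 2 ≤ (1 - t) * d * ‖x‖ ^ 2 := by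
      calc _ ≤ (√((1 - t) * d) * ‖x‖) ^ 2 := by gcongr
        _ = _ := by rw [mul_pow, Real.sq_sqrt (by positivity)]
    have h3 : a / ‖x‖ ^ 2 * ‖applyMatrix (matrixOfEntries B) x - w‖ ^ 2 ≤
        a / ‖x‖ ^ 2 * ((1 - t) * d * ‖x‖ ^ 2) := by gcongr
    have h4 : a / ‖x‖ ^ 2 * ((1 - t) * d * ‖x‖ ^ 2) = d * t / 2 := by
      rw [ha]; field_simp
    linarith
  · rw [lintegral_const_mul _ (by fun_prop)]
    refine (mul_le_mul_right (lintegral_exp_neg_norm_applyMatrix_sub_sq_le hx w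
      (by positivity) fun i => by positivity) _).trans ?_
    rw [← ENNReal.ofReal_mul (Real.exp_pos _).le]
    refine ENNReal.ofReal_le_ofReal (le_of_eq ?_)
    have h1 : 1 + 2 * a = (1 - t)⁻¹ := by rw [ha]; field_simp; ring
    have h2 : √(1 - t) = Real.exp (Real.log (1 - t) / 2) := by
      rw [Real.sqrt_eq_rpow, Real.rpow_def_of_pos h1t]; ring_nf
    rw [h1, Real.sqrt_inv, inv_inv, h2, ← Real.exp_nat_mul, ← Real.exp_add]
    ring_nf

/-- The Chernoff bound for the upper tail of a chi-squared variable with the parameter `4 / 9`, for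
which `(1 - 2 · 4 / 9) ^ (-d / 2) = 3 ^ d`. -/
theorem gaussianEntries_norm_applyMatrix_ge_le {d n : ℕ} {x : EuclideanSpace ℝ (Fin n)}
    (hx : x ≠ 0) {T : ℝ} (hT : 0 ≤ T) :
    gaussianEntries d n {B | T * ‖x‖ ≤ ‖applyMatrix (matrixOfEntries B) x‖} ≤
      ENNReal.ofReal (3 ^ d * Real.exp (-(4 / 9 * T ^ 2))) := by
  have hx0 : 0 < ‖x‖ := norm_pos_iff.2 hx
  have hm := measurable_applyMatrix (d := d) x
  refine (measure_le_lintegral_of_one_le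
    (G := fun B => ENNReal.ofReal (Real.exp (-(4 / 9 * T ^ 2))) * ENNReal.ofReal (Real.exp
      (-(-(4 / 9) / ‖x‖ ^ 2 * ‖applyMatrix (matrixOfEntries B) x - 0‖ ^ 2))))
    (by fun_prop) ?_).trans ?_
  · intro B hB
    rw [Set.mem_ofPred_eq] at hB
    rw [← ENNReal.ofReal_mul (Real.exp_pos _).le, ← Real.exp_add, ← ENNReal.ofReal_one, sub_zero]
    refine ENNReal.ofReal_le_ofReal (Real.one_le_exp ?_)
    have h2 : T ^ 2 * ‖x‖ ^ 2 ≤ ‖applyMatrix (matrixOfEntries B) x‖ ^ 2 := by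
      rw [← mul_pow]; gcongr
    have h3 : T ^ 2 ≤ ‖applyMatrix (matrixOfEntries B) x‖ ^ 2 / ‖x‖ ^ 2 := by
      rwa [le_div_iff₀ (by positivity)]
    have h4 : -(-(4 / 9) / ‖x‖ ^ 2 * ‖applyMatrix (matrixOfEntries B) x‖ ^ 2) =
        4 / 9 * (‖applyMatrix (matrixOfEntries B) x‖ ^ 2 / ‖x‖ ^ 2) := by ring
    rw [h4]
    linarith
  · rw [lintegral_const_mul _ (by fun_prop)]
    refine (mul_le_mul_right (lintegral_exp_neg_norm_applyMatrix_sub_sq_le hx 0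
      (by norm_num) fun i => by simp) _).trans ?_
    rw [← ENNReal.ofReal_mul (Real.exp_pos _).le]
    refine ENNReal.ofReal_le_ofReal (le_of_eq ?_)
    have h1 : √(1 + 2 * -(4 / 9)) = 1 / 3 := by
      rw [show (1 + 2 * -(4 / 9) : ℝ) = (1 / 3) ^ 2 by norm_num]
      exact Real.sqrt_sq (by norm_num)
    rw [h1, mul_comm]
    norm_num

/-! ### The image of the cube -/

/-- The `ℓ¹` norm `‖Aᵀ v‖₁`, for `A` the matrix with entries `B`. -/
noncomputable def colSum {d n : ℕ} (B : Fin d × Fin n → ℝ) (v : EuclideanSpace ℝ (Fin d)) : ℝ :=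
  ∑ j, |∑ i, B (i, j) * v i|

theorem inner_applyMatrix {d n : ℕ} (B : Fin d × Fin n → ℝ) (x : EuclideanSpace ℝ (Fin n))
    (v : EuclideanSpace ℝ (Fin d)) :
    inner ℝ v (applyMatrix (matrixOfEntries B) x) = ∑ j, x j * ∑ i, B (i, j) * v i := by
  simp only [PiLp.inner_apply, applyMatrix_apply, RCLike.inner_apply, conj_trivial,
    Finset.mul_sum, Finset.sum_mul]
  rw [Finset.sum_comm]
  exact Finset.sum_congr rfl fun i _ => Finset.sum_congr rfl fun j _ => by ring

theorem exists_norm_applyMatrix_le_colSum {d n : ℕ} (B : Fin d × Fin n → ℝ)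
    {x : EuclideanSpace ℝ (Fin n)} (hx : ∀ j, |x j| ≤ 1) :
    ∃ v : EuclideanSpace ℝ (Fin d), ‖v‖ ≤ 1 ∧ ‖applyMatrix (matrixOfEntries B) x‖ ≤ colSum B v := by
  set y := applyMatrix (matrixOfEntries B) x with hy
  refine ⟨‖y‖⁻¹ • y, ?_, ?_⟩
  · rw [norm_smul, norm_inv, norm_norm]
    exact inv_mul_le_one
  · have h1 : ‖y‖ = inner ℝ (‖y‖⁻¹ • y) y := by
      rw [real_inner_smul_left, real_inner_self_eq_norm_sq]
      by_cases h : ‖y‖ = 0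
      · simp [h]
      · field_simp
    conv_lhs => rw [h1]
    rw [hy, inner_applyMatrix, ← hy]
    refine Finset.sum_le_sum fun j _ => (le_abs_self _).trans ?_
    rw [abs_mul]
    exact mul_le_of_le_one_left (abs_nonneg _) (hx j)

/-- The vertex `± 1` of the cube `[-1, 1]ⁿ` with the signs `s`. -/
noncomputable def signVector {n : ℕ} (s : Fin n → Bool) : EuclideanSpace ℝ (Fin n) :=
  WithLp.toLp 2 fun j => if s j then 1 else -1

theorem norm_signVector {n : ℕ} (s : Fin n → Bool) : ‖signVector s‖ = √(n : ℝ) := by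
  rw [EuclideanSpace.norm_eq]
  congr 1
  have h : ∀ j, ‖signVector s j‖ ^ 2 = 1 := fun j => by
    simp only [signVector]
    split_ifs <;> simp
  rw [Finset.sum_congr rfl fun j _ => h j]
  simp

theorem exists_colSum_le_norm_applyMatrix_signVector {d n : ℕ} (B : Fin d × Fin n → ℝ)
    {v : EuclideanSpace ℝ (Fin d)} (hv : ‖v‖ ≤ 1) :
    ∃ s, colSum B v ≤ ‖applyMatrix (matrixOfEntries B) (signVector s)‖ := by
  refine ⟨fun j => decide (0 ≤ ∑ i, B (i, j) * v i), ?_⟩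
  have h1 : colSum B v = inner ℝ v (applyMatrix (matrixOfEntries B)
      (signVector fun j => decide (0 ≤ ∑ i, B (i, j) * v i))) := by
    rw [inner_applyMatrix]
    refine Finset.sum_congr rfl fun j _ => ?_
    simp only [signVector, decide_eq_true_eq]
    split_ifs with h
    · rw [abs_of_nonneg h, one_mul]
    · rw [abs_of_neg (not_le.1 h), neg_one_mul]
  rw [h1]
  exact (real_inner_le_norm _ _).trans (mul_le_of_le_one_left (norm_nonneg _) hv)

/-- The mean of `exp ∘ f` over a ball is at least its value at the centre if `f` is midpoint convex,
by pairing the points `u + z` and `u - z`. -/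
theorem exp_mul_volume_closedBall_le {E : Type*} [NormedAddCommGroup E] [InnerProductSpace ℝ E]
    [FiniteDimensional ℝ E] [MeasurableSpace E] [BorelSpace E] {f : E → ℝ} (hf : Continuous f)
    (hmid : ∀ u z, 2 * f u ≤ f (u + z) + f (u - z)) (u : E) (r : ℝ) :
    ENNReal.ofReal (Real.exp (f u)) * volume (Metric.closedBall (0 : E) r) ≤
      ∫⁻ v in Metric.closedBall u r, ENNReal.ofReal (Real.exp (f v)) := by
  set F : E → ℝ≥0∞ := fun v => ENNReal.ofReal (Real.exp (f v)) with hF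
  have hFm : Measurable F := by fun_prop
  have h1 : ∫⁻ z in Metric.closedBall (0 : E) r, F (u + z) = ∫⁻ v in Metric.closedBall u r, F v := by
    have := (measurePreserving_add_left volume u).setLIntegral_comp_preimage
      (Metric.isClosed_closedBall (x := u) (ε := r)).measurableSet hFm
    rw [← this]
    congr 2
    ext z; simp
  have h2 : ∫⁻ z in Metric.closedBall (0 : E) r, F (u - z) = ∫⁻ v in Metric.closedBall u r, F v := by
    have := (Measure.measurePreserving_sub_left volume u).setLIntegral_comp_preimage
      (Metric.isClosed_closedBall (x := u) (ε := r)).measurableSet hFm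
    rw [← this]
    congr 2
    ext z; simp [dist_eq_norm]
  have h3 : ∀ z, 2 * F u ≤ F (u + z) + F (u - z) := by
    intro z
    simp only [hF]
    rw [← ENNReal.ofReal_add (by positivity) (by positivity),
      show (2 : ℝ≥0∞) = ENNReal.ofReal 2 by simp, ← ENNReal.ofReal_mul (by norm_num)]
    refine ENNReal.ofReal_le_ofReal ?_
    have e1 : Real.exp (f u) ≤ Real.exp (f (u + z) / 2) * Real.exp (f (u - z) / 2) := by
      rw [← Real.exp_add]
      exact Real.exp_le_exp.2 (by linarith [hmid u z])
    have e2 : ∀ x, Real.exp x = Real.exp (x / 2) ^ 2 := fun x => by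
      rw [← Real.exp_nat_mul]; ring_nf
    rw [e2 (f (u + z)), e2 (f (u - z))]
    nlinarith [sq_nonneg (Real.exp (f (u + z) / 2) - Real.exp (f (u - z) / 2))]
  have h4 : 2 * (F u * volume (Metric.closedBall (0 : E) r)) ≤
      2 * ∫⁻ v in Metric.closedBall u r, F v := by
    calc _ = ∫⁻ z in Metric.closedBall (0 : E) r, 2 * F u := by
          rw [setLIntegral_const, mul_assoc]
      _ ≤ ∫⁻ z in Metric.closedBall (0 : E) r, (F (u + z) + F (u - z)) :=
          lintegral_mono fun z => h3 z
      _ = _ := by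
          rw [lintegral_add_left (by fun_prop), h1, h2, two_mul]
  exact (ENNReal.mul_le_mul_iff_right two_ne_zero ENNReal.ofNat_ne_top).1 h4

theorem continuous_colSum_uncurry {d n : ℕ} :
    Continuous fun p : (Fin d × Fin n → ℝ) × EuclideanSpace ℝ (Fin d) => colSum p.1 p.2 := by
  unfold colSum
  fun_prop

/-- A bound for the supremum of `‖Aᵀ v‖₁` over the unit ball. In place of a net, `exp (3/10 ‖Aᵀ v‖₁)` is
integrated over the unit ball: if `‖Aᵀ v‖₁ ≥ T`, then the ball of radius `1 / 11` around `(10 / 11) v`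
alone contributes at least `11⁻ᵈ exp (3/11 T)` times the volume of the unit ball. -/
theorem gaussianEntries_exists_colSum_ge_le {d n : ℕ} (T : ℝ) :
    gaussianEntries d n {B | ∃ v, ‖v‖ ≤ 1 ∧ T ≤ colSum B v} ≤
      ENNReal.ofReal (11 ^ d * Real.exp (3 / 11 * n - 3 / 11 * T)) := by
  set V := volume (Metric.closedBall (0 : EuclideanSpace ℝ (Fin d)) 1) with hV
  have hV0 : V ≠ 0 := (Metric.measure_closedBall_pos volume _ one_pos).ne'
  have hVt : V ≠ ⊤ := measure_closedBall_lt_top.ne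
  have hcont := continuous_colSum_uncurry (d := d) (n := n)
  have hmeas : Measurable fun p : (Fin d × Fin n → ℝ) × EuclideanSpace ℝ (Fin d) =>
      ENNReal.ofReal (Real.exp (3 / 10 * colSum p.1 p.2)) := by
    have := hcont.measurable
    fun_prop
  set Z : (Fin d × Fin n → ℝ) → ℝ≥0∞ := fun B => ∫⁻ v in
    Metric.closedBall (0 : EuclideanSpace ℝ (Fin d)) 1,
      ENNReal.ofReal (Real.exp (3 / 10 * colSum B v)) with hZ
  have hZm : Measurable Z := hmeas.lintegral_prod_right'
  have hZint : ∫⁻ B, Z B ∂(gaussianEntries d n) ≤ V * ENNReal.ofReal (Real.exp (3 / 11 * n)) := by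
    rw [hZ, lintegral_lintegral_swap hmeas.aemeasurable]
    have : ∀ v ∈ Metric.closedBall (0 : EuclideanSpace ℝ (Fin d)) 1,
        ∫⁻ B, ENNReal.ofReal (Real.exp (3 / 10 * colSum B v)) ∂(gaussianEntries d n) ≤
          ENNReal.ofReal (Real.exp (3 / 11 * n)) := by
      intro v hv
      rw [mem_closedBall_zero_iff] at hv
      calc _ = ∫⁻ B, ∏ j, (fun y => ENNReal.ofReal (Real.exp (3 / 10 * |y|)))
            (∑ i, B (i, j) * v i) ∂(gaussianEntries d n) := by
            refine lintegral_congr fun B => ?_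
            rw [colSum, Finset.mul_sum, Real.exp_sum,
              ENNReal.ofReal_prod_of_nonneg fun i _ => (Real.exp_pos _).le]
        _ = ∏ _j : Fin n, ∫⁻ y, ENNReal.ofReal (Real.exp (3 / 10 * |‖v‖ * y|))
              ∂(gaussianReal 0 1) :=
            lintegral_prod_cols v (fun _ y => ENNReal.ofReal (Real.exp (3 / 10 * |y|)))
              fun i => by fun_prop
        _ ≤ ∏ _j : Fin n, ENNReal.ofReal (Real.exp (3 / 11)) :=
            Finset.prod_le_prod' fun j _ =>
              lintegral_exp_abs_gaussianReal_le (by rwa [abs_of_nonneg (norm_nonneg _)])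
        _ = _ := by
            rw [Finset.prod_const, Finset.card_univ, Fintype.card_fin,
              ← ENNReal.ofReal_pow (Real.exp_pos _).le, ← Real.exp_nat_mul, mul_comm]
    calc _ ≤ ∫⁻ v in Metric.closedBall (0 : EuclideanSpace ℝ (Fin d)) 1,
          ENNReal.ofReal (Real.exp (3 / 11 * n)) :=
          setLIntegral_mono measurable_const this
      _ = _ := by rw [setLIntegral_const, mul_comm]
  have hlow : ∀ B ∈ {B : Fin d × Fin n → ℝ | ∃ v, ‖v‖ ≤ 1 ∧ T ≤ colSum B v},
      ENNReal.ofReal (Real.exp (3 / 11 * T)) * (ENNReal.ofReal ((1 / 11) ^ d) * V) ≤ Z B := by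
    rintro B ⟨v, hv, hT⟩
    have hsub : Metric.closedBall ((10 / 11 : ℝ) • v) (1 / 11) ⊆ Metric.closedBall 0 1 := by
      refine Metric.closedBall_subset_closedBall' ?_
      rw [dist_zero_right, norm_smul]
      norm_num
      linarith
    have hvol : volume (Metric.closedBall (0 : EuclideanSpace ℝ (Fin d)) (1 / 11)) =
        ENNReal.ofReal ((1 / 11) ^ d) * V := by
      rw [Measure.addHaar_closedBall' _ _ (by norm_num), hV,
        finrank_euclideanSpace_fin]
    have hcB : Continuous fun v => 3 / 10 * colSum B v :=
      (hcont.comp (Continuous.prodMk_right B)).const_mul _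
    have hjen := exp_mul_volume_closedBall_le hcB (fun u z => by
      have : 2 * colSum B u ≤ colSum B (u + z) + colSum B (u - z) := by
        unfold colSum
        rw [Finset.mul_sum, ← Finset.sum_add_distrib]
        refine Finset.sum_le_sum fun j _ => ?_
        have e : ∑ i, B (i, j) * (u + z) i + ∑ i, B (i, j) * (u - z) i =
            2 * ∑ i, B (i, j) * u i := by
          rw [← Finset.sum_add_distrib, Finset.mul_sum]
          refine Finset.sum_congr rfl fun i _ => ?_
          simp only [PiLp.add_apply, PiLp.sub_apply]
          ring
        calc _ = |∑ i, B (i, j) * (u + z) i + ∑ i, B (i, j) * (u - z) i| := by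
              rw [e, abs_mul, abs_two]
          _ ≤ _ := abs_add_le _ _
      linarith) ((10 / 11 : ℝ) • v) (1 / 11)
    rw [hvol] at hjen
    refine le_trans ?_ (hjen.trans (lintegral_mono_set hsub))
    refine mul_le_mul' (ENNReal.ofReal_le_ofReal (Real.exp_le_exp.2 ?_)) le_rfl
    have : colSum B ((10 / 11 : ℝ) • v) = 10 / 11 * colSum B v := by
      unfold colSum
      rw [Finset.mul_sum]
      refine Finset.sum_congr rfl fun j _ => ?_
      rw [← abs_of_pos (show (0 : ℝ) < 10 / 11 by norm_num), ← abs_mul, Finset.mul_sum,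
        abs_of_pos (show (0 : ℝ) < 10 / 11 by norm_num)]
      congr 1
      refine Finset.sum_congr rfl fun i _ => ?_
      simp only [PiLp.smul_apply, smul_eq_mul]
      ring
    rw [this]
    linarith
  refine (measure_le_lintegral_of_one_le
    (G := fun B => ENNReal.ofReal (11 ^ d * Real.exp (-(3 / 11 * T))) * V⁻¹ * Z B)
    (by fun_prop) ?_).trans ?_
  · intro B hB
    refine le_trans (le_of_eq ?_) (mul_le_mul_right (hlow B hB) _)
    rw [show ∀ a b c e f : ℝ≥0∞, a * b * (c * (e * f)) = a * c * e * (b * f) from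
      fun a b c e f => by ring, ENNReal.inv_mul_cancel hV0 hVt, mul_one,
      ← ENNReal.ofReal_mul (by positivity), ← ENNReal.ofReal_mul (by positivity)]
    rw [show (11 : ℝ) ^ d * Real.exp (-(3 / 11 * T)) * Real.exp (3 / 11 * T) * (1 / 11) ^ d =
      (11 * (1 / 11)) ^ d * (Real.exp (-(3 / 11 * T)) * Real.exp (3 / 11 * T)) by
        rw [mul_pow]; ring, ← Real.exp_add]
    norm_num
  · rw [lintegral_const_mul _ hZm]
    refine (mul_le_mul_right hZint _).trans (le_of_eq ?_)
    rw [show ∀ a b c e : ℝ≥0∞, a * b * (c * e) = a * e * (b * c) from fun a b c e => by ring,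
      ENNReal.inv_mul_cancel hV0 hVt, mul_one, ← ENNReal.ofReal_mul (by positivity), mul_assoc,
      ← Real.exp_add]
    ring_nf

/-- Outside an event of probability at most `exp (-d / 2)`, a Gaussian matrix stretches no vector of
the cube `[-1, 1]ⁿ` beyond `√n (√n + 2 √d)`. -/
theorem gaussianEntries_cube_le {d n : ℕ} :
    gaussianEntries d n {B | ∃ x : EuclideanSpace ℝ (Fin n), (∀ j, |x j| ≤ 1) ∧
      √n * (√n + 2 * √d) < ‖applyMatrix (matrixOfEntries B) x‖} ≤
      ENNReal.ofReal (Real.exp (-((d : ℝ) / 2))) := by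
  set a := √(n : ℝ) with ha
  set b := √(d : ℝ) with hb
  have ha0 : 0 ≤ a := Real.sqrt_nonneg _
  have hb0 : 0 ≤ b := Real.sqrt_nonneg _
  have ha2 : a ^ 2 = n := Real.sq_sqrt (by positivity)
  have hb2 : b ^ 2 = d := Real.sq_sqrt (by positivity)
  have hsub : {B : Fin d × Fin n → ℝ | ∃ x : EuclideanSpace ℝ (Fin n), (∀ j, |x j| ≤ 1) ∧
      a * (a + 2 * b) < ‖applyMatrix (matrixOfEntries B) x‖} ⊆
      {B | ∃ v, ‖v‖ ≤ 1 ∧ a * (a + 2 * b) ≤ colSum B v} := by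
    rintro B ⟨x, hx, hlt⟩
    obtain ⟨v, hv, hle⟩ := exists_norm_applyMatrix_le_colSum B hx
    exact ⟨v, hv, hlt.le.trans hle⟩
  rcases Nat.eq_zero_or_pos n with rfl | hn
  · refine le_trans (measure_mono_null (t := ∅) ?_ measure_empty).le zero_le
    rintro B ⟨x, -, hlt⟩
    have : x = 0 := Subsingleton.elim _ _
    have h0 : applyMatrix (matrixOfEntries B) x = 0 := by
      ext i
      simp [applyMatrix_apply]
    rw [h0, norm_zero] at hlt
    exact absurd hlt (not_lt.2 (by positivity))
  refine (measure_mono hsub).trans ?_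
  have hapos : 0 < a := Real.sqrt_pos.2 (by exact_mod_cast hn)
  rcases le_total a (6 * b) with hab | hab
  -- If `n ≤ 36 d`, a union bound over the `2ⁿ` vertices of the cube is affordable.
  · have hU : {B : Fin d × Fin n → ℝ | ∃ v, ‖v‖ ≤ 1 ∧ a * (a + 2 * b) ≤ colSum B v} ⊆
        ⋃ s : Fin n → Bool, {B | (a + 2 * b) * ‖signVector s‖ ≤
          ‖applyMatrix (matrixOfEntries B) (signVector s)‖} := by
      rintro B ⟨v, hv, hle⟩
      obtain ⟨s, hs⟩ := exists_colSum_le_norm_applyMatrix_signVector B hv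
      refine Set.mem_iUnion.2 ⟨s, ?_⟩
      rw [Set.mem_ofPred_eq, norm_signVector, mul_comm]
      exact hle.trans hs
    have hne : ∀ s : Fin n → Bool, signVector s ≠ 0 := fun s h => by
      have := norm_signVector s
      rw [h, norm_zero] at this
      exact hapos.ne this
    calc _ ≤ ∑ s : Fin n → Bool, gaussianEntries d n {B | (a + 2 * b) * ‖signVector s‖ ≤
          ‖applyMatrix (matrixOfEntries B) (signVector s)‖} :=
          (measure_mono hU).trans (measure_iUnion_fintype_le _ _)
      _ ≤ ∑ _s : Fin n → Bool, ENNReal.ofReal (3 ^ d * Real.exp (-(4 / 9 * (a + 2 * b) ^ 2))) :=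
          Finset.sum_le_sum fun s _ =>
            gaussianEntries_norm_applyMatrix_ge_le (hne s) (by positivity)
      _ = ENNReal.ofReal (2 ^ n * (3 ^ d * Real.exp (-(4 / 9 * (a + 2 * b) ^ 2)))) := by
          rw [Finset.sum_const, Finset.card_univ, nsmul_eq_mul, ENNReal.ofReal_mul (by positivity)]
          simp [ENNReal.ofReal_pow]
      _ ≤ _ := by
          refine ENNReal.ofReal_le_ofReal ?_
          have h2 : (2 : ℝ) ^ n ≤ Real.exp (0.694 * a ^ 2) := by
            rw [ha2, mul_comm, Real.exp_nat_mul]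
            gcongr
            rw [← Real.exp_log (show (0 : ℝ) < 2 by norm_num)]
            exact Real.exp_le_exp.2 (by linarith [Real.log_two_lt_d9])
          have h3 : (3 : ℝ) ^ d ≤ Real.exp (1.1 * b ^ 2) := by
            rw [hb2, mul_comm, Real.exp_nat_mul]
            gcongr
            refine le_trans ?_ (Real.sum_le_exp_of_nonneg (by norm_num) 7)
            norm_num [Finset.sum_range_succ, Nat.factorial]
          calc _ ≤ Real.exp (0.694 * a ^ 2) * (Real.exp (1.1 * b ^ 2) *
                Real.exp (-(4 / 9 * (a + 2 * b) ^ 2))) := by gcongr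
            _ ≤ _ := by
                rw [← Real.exp_add, ← Real.exp_add, ← hb2]
                refine Real.exp_le_exp.2 ?_
                nlinarith [mul_le_mul_of_nonneg_left hab ha0, mul_nonneg ha0 hb0, sq_nonneg b]
  -- If `n ≥ 36 d`, the cross term `2 √(n d)` beats the entropy factor `11ᵈ` of the unit ball.
  · refine (gaussianEntries_exists_colSum_ge_le _).trans (ENNReal.ofReal_le_ofReal ?_)
    have h11 : (11 : ℝ) ^ d ≤ Real.exp (2.5 * b ^ 2) := by
      rw [hb2, mul_comm, Real.exp_nat_mul]
      gcongr
      refine le_trans ?_ (Real.sum_le_exp_of_nonneg (by norm_num) 7)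
      norm_num [Finset.sum_range_succ, Nat.factorial]
    calc _ ≤ Real.exp (2.5 * b ^ 2) * Real.exp (3 / 11 * n - 3 / 11 * (a * (a + 2 * b))) := by
          gcongr
      _ ≤ _ := by
          rw [← Real.exp_add, ← hb2, ← ha2]
          refine Real.exp_le_exp.2 ?_
          nlinarith [mul_le_mul_of_nonneg_right hab hb0]

/-! ### Counting describable vectors -/

theorem IsBinaryExpansion.unique {n : ℕ} {s : List Bool} {u v : EuclideanSpace ℝ (Fin n)}
    (hu : IsBinaryExpansion s u) (hv : IsBinaryExpansion s v) : u = v := by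
  obtain ⟨k, b, -, hb, hub, hs⟩ := hu
  obtain ⟨l, c, -, hc, hvc, hs'⟩ := hv
  have hlen : ∀ (k : ℕ) (b : Fin n → List Bool), (∀ i, (b i).length = k) →
      (List.ofFn b).map List.length = List.replicate n k := by
    intro k b hb
    rw [List.map_ofFn, ← List.ofFn_const]
    congr 1
    exact funext hb
  have hnk : n * k = n * l := by
    have h := congrArg List.length (hs.symm.trans hs')
    simpa [List.length_flatten, hlen k b hb, hlen l c hc] using h
  ext i
  have hkl : k = l := Nat.eq_of_mul_eq_mul_left i.pos hnk
  subst hkl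
  have hbc : List.ofFn b = List.ofFn c :=
    List.eq_iff_flatten_eq.2 ⟨hs.symm.trans hs', by rw [hlen k b hb, hlen k c hc]⟩
  rw [hub, hvc, List.ofFn_injective hbc]

/-- The vectors of which `U`, given `y`, prints a binary expansion on some program of length at
most `k`. -/
def describableVectors (U : PrefixComputer) (n k : ℕ) (y : List ℕ) :
    Set (EuclideanSpace ℝ (Fin n)) :=
  {u | ∃ s p, IsBinaryExpansion s u ∧ s ∈ U.run p y ∧ p.length ≤ k}

/-- Programs of a prefix computer of length at most `k` stay distinct when padded to length `k`, so
there are at most `2 ^ k` of them. -/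
theorem finite_describableVectors_and_ncard_le (U : PrefixComputer) (n k : ℕ) (y : List ℕ) :
    (describableVectors U n k y).Finite ∧ (describableVectors U n k y).ncard ≤ 2 ^ k := by
  choose s p hs hp hk using fun u : describableVectors U n k y => u.2
  let f : describableVectors U n k y → List.Vector Bool k := fun u =>
    ⟨p u ++ List.replicate (k - (p u).length) false, by simp [hk u]⟩
  have hf : Function.Injective f := by
    have key : ∀ u v, f u = f v → (p u).length ≤ (p v).length → u = v := by
      intro u v h hle
      have h' : p u ++ List.replicate (k - (p u).length) false =
        p v ++ List.replicate (k - (p v).length) false := congrArg Subtype.val h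
      have hpre : p u <+: p v := List.prefix_of_prefix_length_le (h' ▸ List.prefix_append _ _)
        (List.prefix_append _ _) hle
      have hpuv : p u = p v := U.prefixFree y _ _ (Part.dom_iff_mem.2 ⟨_, hp u⟩)
        (Part.dom_iff_mem.2 ⟨_, hp v⟩) hpre
      have hsuv : s u = s v := Part.mem_unique (hp u) (hpuv ▸ hp v)
      exact Subtype.ext ((hs u).unique (hsuv ▸ hs v))
    intro u v h
    rcases le_total (p u).length (p v).length with hle | hle
    · exact key u v h hle
    · exact (key v u h.symm hle).symm
  refine ⟨Set.finite_coe_iff.1 (Finite.of_injective f hf), ?_⟩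
  have := Nat.card_le_card_of_injective f hf
  simpa [Nat.card_eq_fintype_card, card_vector] using this

/-- The infimum in `resolutionComplexity`, once finite, is attained. -/
theorem exists_describableVector_of_resolutionComplexity_le {U : PrefixComputer} {m n k : ℕ}
    {x : EuclideanSpace ℝ (Fin n)} (h : resolutionComplexity U m x ≤ k) :
    ∃ u ∈ describableVectors U n k [n, m], ∀ i, |x i - u i| ≤ (2 : ℝ)⁻¹ ^ m := by
  have hlt : resolutionComplexity U m x < (k + 1 : ℕ) :=
    h.trans_lt (by exact_mod_cast Nat.lt_succ_self k)
  simp only [resolutionComplexity, vectorComplexity, PrefixComputer.complexity, iInf_lt_iff,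
    exists_prop, Nat.cast_lt] at hlt
  obtain ⟨u, -, hxu, s, hs, p, hp, hlen⟩ := hlt
  exact ⟨u, ⟨s, p, hs, hp, Nat.lt_succ_iff.1 hlen⟩, hxu⟩

/-! ### Recovery -/

theorem norm_le_mul_sqrt_of_abs_le {n : ℕ} {z : EuclideanSpace ℝ (Fin n)} {δ : ℝ} (hδ : 0 ≤ δ)
    (hz : ∀ i, |z i| ≤ δ) : ‖z‖ ≤ δ * √(n : ℝ) := by
  rw [EuclideanSpace.norm_eq]
  refine Real.sqrt_le_iff.2 ⟨by positivity, ?_⟩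
  rw [mul_pow, Real.sq_sqrt (by positivity)]
  calc _ ≤ ∑ _i : Fin n, δ ^ 2 := Finset.sum_le_sum fun i _ => by
        rw [Real.norm_eq_abs]
        exact pow_le_pow_left₀ (abs_nonneg _) (hz i) 2
    _ = _ := by simp [mul_comm]

theorem applyMatrix_sub {d n : ℕ} (A : Matrix (Fin d) (Fin n) ℝ) (x y : EuclideanSpace ℝ (Fin n)) :
    applyMatrix A (x - y) = applyMatrix A x - applyMatrix A y := by
  ext i
  simp [applyMatrix, Matrix.mulVec_sub]

theorem applyMatrix_smul {d n : ℕ} (A : Matrix (Fin d) (Fin n) ℝ) (c : ℝ)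
    (x : EuclideanSpace ℝ (Fin n)) : applyMatrix A (c • x) = c • applyMatrix A x := by
  ext i
  simp [applyMatrix, Matrix.mulVec_smul]

/-- The error bound for the least squares solution `x` with noise `w`, where `u` is a quantization of
`x` at the scale `δ`. The residual of `x` is at most `‖w‖`, that of `u` is larger by at most the
stretching of `u - x`, and `hu` turns the residual of `u` into a bound for `‖u - x₀‖`. -/
theorem norm_sub_le_of_norm_applyMatrix_sub_le {d n : ℕ} (hd : 0 < d) {A : Matrix (Fin d) (Fin n) ℝ}
    {x₀ x u : EuclideanSpace ℝ (Fin n)} {w : EuclideanSpace ℝ (Fin d)} {e t δ : ℝ}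
    (hw : ‖w‖ ≤ e) (ht : t < 1) (hδ : 0 < δ) (hxu : ∀ i, |x i - u i| ≤ δ)
    (hx : ‖applyMatrix A x - (applyMatrix A x₀ + w)‖ ≤ ‖w‖)
    (hA : ∀ z : EuclideanSpace ℝ (Fin n), (∀ j, |z j| ≤ 1) →
      ‖applyMatrix A z‖ ≤ √n * (√n + 2 * √d))
    (hu : u ≠ x₀ → √((1 - t) * d) * ‖u - x₀‖ ≤ ‖applyMatrix A (u - x₀) - w‖) :
    ‖x₀ - x‖ ≤ (1 / √(1 - t) * (√((n : ℝ) / d) + 2) + 1) * δ * √(n : ℝ) + e / √((1 - t) * d) := by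
  have h1t : 0 < 1 - t := by linarith
  have hd' : (0 : ℝ) < d := by exact_mod_cast hd
  have hr : 0 < √(1 - t) := Real.sqrt_pos.2 h1t
  have hb : 0 < √(d : ℝ) := Real.sqrt_pos.2 hd'
  have ha : 0 ≤ √(n : ℝ) := Real.sqrt_nonneg _
  have he : 0 ≤ e := (norm_nonneg w).trans hw
  rw [Real.sqrt_div (by positivity), Real.sqrt_mul h1t.le]
  rw [Real.sqrt_mul h1t.le] at hu
  set a := √(n : ℝ)
  set b := √(d : ℝ)
  set r := √(1 - t)
  have hzA : ‖applyMatrix A (u - x)‖ ≤ δ * (a * (a + 2 * b)) := by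
    have h1 := hA (δ⁻¹ • (u - x)) fun j => by
      rw [PiLp.smul_apply, PiLp.sub_apply, smul_eq_mul, abs_mul, abs_of_pos (inv_pos.2 hδ),
        abs_sub_comm, inv_mul_le_iff₀ hδ, mul_one]
      exact hxu j
    rwa [applyMatrix_smul, norm_smul, norm_inv, Real.norm_of_nonneg hδ.le, inv_mul_le_iff₀ hδ] at h1
  have hux : ‖u - x₀‖ ≤ (e + δ * (a * (a + 2 * b))) / (r * b) := by
    by_cases h : u = x₀
    · rw [h, sub_self, norm_zero]
      positivity
    · rw [le_div_iff₀ (by positivity), mul_comm]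
      refine (hu h).trans ?_
      have e1 : applyMatrix A (u - x₀) - w =
          (applyMatrix A x - (applyMatrix A x₀ + w)) + applyMatrix A (u - x) := by
        rw [applyMatrix_sub, applyMatrix_sub]
        abel
      rw [e1]
      exact (norm_add_le _ _).trans (add_le_add (hx.trans hw) hzA)
  have hxu' : ‖x - u‖ ≤ δ * a := norm_le_mul_sqrt_of_abs_le hδ.le hxu
  calc ‖x₀ - x‖ = ‖(u - x₀) + (x - u)‖ := by rw [← norm_neg]; congr 1; abel
    _ ≤ (e + δ * (a * (a + 2 * b))) / (r * b) + δ * a := (norm_add_le _ _).trans (add_le_add hux hxu')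
    _ = _ := by field_simp; ring

theorem theorem3 (U : PrefixComputer) (hU : U.IsOptimal)
    {n d m : ℕ} (hd : 0 < d) (hm : 0 < m)
    (x₀ : EuclideanSpace ℝ (Fin n)) (hx₀ : x₀ ∈ unitCube n)
    (w : EuclideanSpace ℝ (Fin d)) (e : ℝ) (hw : ‖w‖ ≤ e)
    {Ω : Type*} [MeasurableSpace Ω] (μ : Measure Ω) [IsProbabilityMeasure μ]
    (A : Ω → Matrix (Fin d) (Fin n) ℝ)
    (hA_indep : iIndepFun (fun (p : Fin d × Fin n) (ω : Ω) => A ω p.1 p.2) μ)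
    (hA_law : ∀ i j, HasLaw (fun ω => A ω i j) (gaussianReal 0 1) μ)
    (xhat : Ω → EuclideanSpace ℝ (Fin n))
    (hxhat : ∀ ω, IsLLSSolution U m (kid U m x₀) (A ω) (applyMatrix (A ω) x₀ + w) (xhat ω))
    (t : ℝ) (ht : t ∈ Set.Ioo (0 : ℝ) 1) :
    μ.real {ω | (1 / √(1 - t) * (√((n : ℝ) / d) + 2) + 1) * (2 : ℝ)⁻¹ ^ m * √(n : ℝ)
          + e / √((1 - t) * d) < ‖x₀ - xhat ω‖}
      ≤ (2 : ℝ) ^ (kid U m x₀ * m) * Real.exp ((d : ℝ) / 2 * (t + Real.log (1 - t)))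
        + Real.exp (-((d : ℝ) / 2)) := by
  set k := (resolutionComplexity U m x₀).toNat with hk
  have hkx₀ : resolutionComplexity U m x₀ = k :=
    (ENat.natCast_toNat (resolutionComplexity_ne_top U hU m x₀ hx₀)).symm
  have hkid : kid U m x₀ * m = k := by
    rw [kid, div_mul_cancel₀ _ (by exact_mod_cast hm.ne')]
  have hfeas : ∀ x, x ∈ llsFeasible U m n (kid U m x₀) ↔
      x ∈ unitCube n ∧ resolutionComplexity U m x ≤ k := by
    intro x
    rw [llsFeasible, Set.mem_ofPred_eq, hkid, ENNReal.ofReal_natCast,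
      ← ENat.toENNReal_coe, ENat.toENNReal_le]
  rw [hkid, Real.rpow_natCast]
  obtain ⟨hfin, hcard⟩ := finite_describableVectors_and_ncard_le U n k [n, m]
  set B : Ω → Fin d × Fin n → ℝ := fun ω p => A ω p.1 p.2 with hB
  -- `xhat` need not be measurable: the event is covered by preimages, under `B`, of events for the
  -- entries alone, and `Measure.le_map_apply` bounds their outer measure.
  have hBm : AEMeasurable B μ := aemeasurable_pi_lambda _ fun p => (hA_law p.1 p.2).aemeasurable
  have hBlaw : μ.map B = gaussianEntries d n := by
    refine (hA_indep.map_fun_eq_pi_map fun (p : Fin d × Fin n) => (hA_law p.1 p.2).aemeasurable).trans ?_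
    exact congrArg Measure.pi (funext fun p => (hA_law p.1 p.2).map_eq)
  set small : EuclideanSpace ℝ (Fin n) → Set (Fin d × Fin n → ℝ) := fun u =>
    {B | u ≠ x₀ ∧ ‖applyMatrix (matrixOfEntries B) (u - x₀) - w‖ ≤ √((1 - t) * d) * ‖u - x₀‖}
  set large : Set (Fin d × Fin n → ℝ) := {B | ∃ z : EuclideanSpace ℝ (Fin n),
    (∀ j, |z j| ≤ 1) ∧ √n * (√n + 2 * √d) < ‖applyMatrix (matrixOfEntries B) z‖}
  have hsmall : ∀ u, gaussianEntries d n (small u) ≤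
      ENNReal.ofReal (Real.exp ((d : ℝ) / 2 * (t + Real.log (1 - t)))) := by
    intro u
    by_cases h : u = x₀
    · simp [small, h]
    · exact (measure_mono fun B hB => hB.2).trans
        (gaussianEntries_smallBall_le (sub_ne_zero.2 h) w ht)
  have hsub : {ω | (1 / √(1 - t) * (√((n : ℝ) / d) + 2) + 1) * (2 : ℝ)⁻¹ ^ m * √(n : ℝ)
      + e / √((1 - t) * d) < ‖x₀ - xhat ω‖} ⊆
      B ⁻¹' ((⋃ u ∈ hfin.toFinset, small u) ∪ large) := by
    intro ω hω
    by_contra hbad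
    simp only [Set.mem_preimage, Set.mem_union, Set.mem_iUnion, not_or, not_exists] at hbad
    obtain ⟨hns, hnl⟩ := hbad
    obtain ⟨hxf, hmin⟩ := hxhat ω
    obtain ⟨u, hu, hxu⟩ := exists_describableVector_of_resolutionComplexity_le ((hfeas _).1 hxf).2
    have hx := hmin x₀ ((hfeas _).2 ⟨hx₀, hkx₀.le⟩)
    rw [sub_add_cancel_left, norm_neg] at hx
    refine absurd hω (not_lt.2 (norm_sub_le_of_norm_applyMatrix_sub_le hd hw ht.2 (by positivity)
      hxu hx (fun z hz => ?_) fun hne => ?_))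
    · by_contra hlt
      exact hnl ⟨z, hz, not_le.1 hlt⟩
    · by_contra hlt
      exact hns u (hfin.mem_toFinset.2 hu) ⟨hne, (not_le.1 hlt).le⟩
  refine ENNReal.toReal_le_of_le_ofReal (by positivity) ?_
  calc _ ≤ μ.map B ((⋃ u ∈ hfin.toFinset, small u) ∪ large) :=
        (measure_mono hsub).trans (Measure.le_map_apply hBm _)
    _ ≤ (∑ u ∈ hfin.toFinset, gaussianEntries d n (small u)) + gaussianEntries d n large := by
        rw [hBlaw]
        exact (measure_union_le _ _).trans (add_le_add (measure_biUnion_finset_le _ _) le_rfl)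
    _ ≤ 2 ^ k * ENNReal.ofReal (Real.exp ((d : ℝ) / 2 * (t + Real.log (1 - t)))) +
          ENNReal.ofReal (Real.exp (-((d : ℝ) / 2))) := by
        refine add_le_add ?_ gaussianEntries_cube_le
        refine (Finset.sum_le_card_nsmul _ _ _ fun u _ => hsmall u).trans ?_
        rw [nsmul_eq_mul, ← Set.ncard_eq_toFinset_card _ hfin]
        gcongr
        exact_mod_cast hcard
    _ = _ := by
        rw [ENNReal.ofReal_add (by positivity) (by positivity), ENNReal.ofReal_mul (by positivity),
          ENNReal.ofReal_pow (by norm_num)]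
        simp
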